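/- Let $R$ be a commutative ring, $p$ a prime number and $F(x,y)\in R[[x,y]]$ a one-dimensional formal group law over $R$, that is, $F(F(x,y),z)=F(x,F(y,z))$ and $F(x,y)\equiv x+y \pmod{(x,y)^2}$. Write $a+_F b=F(a,b)$. For $n\ge 0$ let $[n]_F=[n]_F(t)\in R[[t]]$ be the $n$-series ($[0]_F=0$ and $[n+1]_F=F(t,[n]_F)$), and let $\langle n\rangle_F=[n]_F(t)/t\in R[[t]]$. Let $D=D_F$ be the $F$-Weyl algebra of $\mathbf{G}_m$: the $R[[t]]$-algebra of finite sums $\sum_{n\in\mathbf{Z}} x^n f_n$ with $f_n\in R[[t]][[y]]$, in which $x$ is invertible and $f(y)\,x=x\,f(F(y,t))$ for all $f\in R[[t]][[y]]$; in particular $yx=xF(y,t)$. Assume that $p$ is a non-zero-divisor in $R$ (for instance, that $R$ is torsion-free), or, more generally, that $t$ is a non-zero-divisor in $R[[t]]/\langle p\rangle_F$. Put $z_F=\prod_{j=0}^{p-1}(y+_F[j]_F)\in R[[t]][[y]]$. Then there is an isomorphism of $R[[t]]$-algebras $$R[[t]][[z]][u^{\pm 1}]/\langle p\rangle_F\;\xrightarrow{\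 \sim\ }\; Z\bigl(D\otimes_{R[[t]]}R[[t]]/\langle p\rangle_F\bigr)$$ onto the center of $D\otimes_{R[[t]]}R[[t]]/\langle p\rangle_F$, which sends $u^n$ to the class of $x^{pn}$ for every $n\in\mathbf{Z}$, and sends every power series $g(z)\in R[[t]][[z]]$ to the class of $g(z_F)$. In other words, the center is $R[[t]][[z_F]][x^{\pm p}]/\langle p\rangle_F$, generated (with power series in $z_F$ allowed) by $x^{\pm p}$ and $\prod_{j=0}^{p-1}(y+_F[j]_F)$. -/

import Mathlib

open scoped TensorProduct LaurentPolynomial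

noncomputable section

namespace FWeyl

variable {R : Type*} [CommRing R]

/-- The `n`-series `[n]_F(t) = F(t, F(t, … F(t, t) …)) ∈ R⟦t⟧` (with `n` copies of `t`). -/
def nSeries (F : FormalGroup R) : ℕ → PowerSeries R
  | 0 => 0
  | n + 1 => MvPowerSeries.subst ![PowerSeries.X, nSeries F n] F.toPowerSeries

/-- The quotient `⟨n⟩_F = [n]_F(t) / t ∈ R⟦t⟧`. -/
def angle (F : FormalGroup R) (n : ℕ) : PowerSeries R :=
  PowerSeries.mk fun k => PowerSeries.coeff (k + 1) (nSeries F n)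

theorem constantCoeff_nSeries (F : FormalGroup R) (n : ℕ) :
    PowerSeries.constantCoeff (nSeries F n) = 0 := by
  induction n with
  | zero => simp [nSeries]
  | succ n ih =>
    have h : ∀ i, MvPowerSeries.constantCoeff
        ((![PowerSeries.X, nSeries F n] : Fin 2 → MvPowerSeries Unit R) i) = 0 := fun i => by
      fin_cases i
      · exact PowerSeries.constantCoeff_X
      · exact ih
    exact MvPowerSeries.constantCoeff_subst_eq_zero
      (MvPowerSeries.hasSubst_of_constantCoeff_zero h) h F.zero_constantCoeff

theorem X_mul_angle (F : FormalGroup R) (n : ℕ) : PowerSeries.X * angle F n = nSeries F n := by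
  ext k
  cases k with
  | zero => simp [constantCoeff_nSeries]
  | succ k => simp [angle]

/-- `R⟦y, t⟧` (variable `0` is `y`, variable `1` is `t`) as an algebra over `R⟦t⟧`. -/
instance algebraT : Algebra (PowerSeries R) (MvPowerSeries (Fin 2) R) :=
  (PowerSeries.substAlgHom (R := R) (S := R)
    (PowerSeries.HasSubst.X (1 : Fin 2))).toRingHom.toAlgebra

/-- The series `y +_F f(t) = F(y, f(t)) ∈ R⟦y, t⟧`. -/
def yAdd (F : FormalGroup R) (f : PowerSeries R) : MvPowerSeries (Fin 2) R :=
  MvPowerSeries.subst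
    ![MvPowerSeries.X 0, algebraMap (PowerSeries R) (MvPowerSeries (Fin 2) R) f] F.toPowerSeries

/-- The product `∏_{j=0}^{p-1} (y +_F [j]_F(t)) ∈ R⟦y, t⟧`. -/
def normY (F : FormalGroup R) (p : ℕ) : MvPowerSeries (Fin 2) R :=
  ∏ j ∈ Finset.range p, yAdd F (nSeries F j)

open MvPowerSeries in
theorem constantCoeff_algebraMapT (f : PowerSeries R) (hf : PowerSeries.constantCoeff f = 0) :
    constantCoeff (algebraMap (PowerSeries R) (MvPowerSeries (Fin 2) R) f) = 0 := by
  change constantCoeff (PowerSeries.substAlgHom (PowerSeries.HasSubst.X (1 : Fin 2)) f) = 0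
  rw [PowerSeries.coe_substAlgHom]
  exact PowerSeries.constantCoeff_subst_eq_zero (by simp) f hf

theorem algebraMapT_X : algebraMap (PowerSeries R) (MvPowerSeries (Fin 2) R) PowerSeries.X
    = MvPowerSeries.X 1 := by
  change PowerSeries.substAlgHom (PowerSeries.HasSubst.X (1 : Fin 2)) PowerSeries.X = _
  rw [PowerSeries.coe_substAlgHom, PowerSeries.subst_X (PowerSeries.HasSubst.X (1 : Fin 2))]

open MvPowerSeries in
theorem hasSubst_shift (F : FormalGroup R) :
    HasSubst ![yAdd F PowerSeries.X, (X 1 : MvPowerSeries (Fin 2) R)] := by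
  refine hasSubst_of_constantCoeff_zero fun s => ?_
  fin_cases s
  · simp only [yAdd, algebraMapT_X]
    exact constantCoeff_subst_eq_zero HasSubst.X_X (fun i => by fin_cases i <;> simp)
      F.zero_constantCoeff
  · simp

/-- The endomorphism `f(y, t) ↦ f(F(y, t), t)` of `R⟦y, t⟧`. -/
def shift (F : FormalGroup R) : MvPowerSeries (Fin 2) R →ₐ[R] MvPowerSeries (Fin 2) R :=
  MvPowerSeries.substAlgHom (hasSubst_shift F)

theorem shift_X_zero (F : FormalGroup R) :
    shift F (MvPowerSeries.X 0) = yAdd F PowerSeries.X := by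
  simp [shift, MvPowerSeries.subst_X (hasSubst_shift F)]

theorem shift_X_one (F : FormalGroup R) :
    shift F (MvPowerSeries.X 1) = MvPowerSeries.X 1 := by
  simp [shift, MvPowerSeries.subst_X (hasSubst_shift F)]

open MvPowerSeries in
theorem shift_algebraMapT (F : FormalGroup R) (f : PowerSeries R) :
    shift F (algebraMap (PowerSeries R) _ f) = algebraMap (PowerSeries R) _ f := by
  change shift F (PowerSeries.substAlgHom (PowerSeries.HasSubst.X (1 : Fin 2)) f) =
    PowerSeries.substAlgHom (PowerSeries.HasSubst.X (1 : Fin 2)) f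
  rw [PowerSeries.coe_substAlgHom, shift, substAlgHom_apply, PowerSeries.subst,
    subst_comp_subst_apply (PowerSeries.HasSubst.X (1 : Fin 2)).const (hasSubst_shift F)]
  simp [subst_X (hasSubst_shift F)]

open MvPowerSeries in
theorem coeff_subst_t_zero (f : MvPowerSeries (Fin 2) R) (m : Fin 2 →₀ ℕ) (hm : m 1 = 0) :
    coeff m (subst ![X 0, (0 : MvPowerSeries (Fin 2) R)] f) = coeff m f := by
  classical
  rw [coeff_subst HasSubst.X_zero, finsum_eq_single _ m]
  · have h : m = Finsupp.single 0 (m 0) := by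
      ext i; fin_cases i <;> simp [hm]
    rw [Finsupp.prod_fintype _ _ (by simp)]
    simp only [Fin.prod_univ_two, Matrix.cons_val_zero, Matrix.cons_val_one, hm, pow_zero, mul_one]
    rw [coeff_X_pow, if_pos h, smul_eq_mul, mul_one]
  · intro d hd
    rw [Finsupp.prod_fintype _ _ (by simp)]
    simp only [Fin.prod_univ_two, Matrix.cons_val_zero, Matrix.cons_val_one]
    by_cases h1 : d 1 = 0
    · rw [h1, pow_zero, mul_one, coeff_X_pow, if_neg, smul_zero]
      intro h
      apply hd
      ext i
      fin_cases i
      · simp [h]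
      · simp [h1, hm]
    · simp [zero_pow h1]

open MvPowerSeries in
theorem X_one_dvd_shift_sub (F : FormalGroup R) (f : MvPowerSeries (Fin 2) R) :
    X 1 ∣ shift F f - f := by
  rw [X_dvd_iff]
  intro m hm
  have key : subst ![X 0, (0 : MvPowerSeries (Fin 2) R)] (shift F f) =
      subst ![X 0, (0 : MvPowerSeries (Fin 2) R)] f := by
    rw [shift, substAlgHom_apply, subst_comp_subst_apply (hasSubst_shift F) HasSubst.X_zero]
    congr 1
    funext i
    fin_cases i
    · simp only [yAdd, algebraMapT_X, Fin.zero_eta, Matrix.cons_val_zero]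
      rw [subst_comp_subst_apply HasSubst.X_X HasSubst.X_zero]
      have : (fun s : Fin 2 => subst ![X 0, (0 : MvPowerSeries (Fin 2) R)]
          ((![X 0, X 1] : Fin 2 → MvPowerSeries (Fin 2) R) s)) = ![X 0, 0] := by
        funext s
        fin_cases s <;> simp [subst_X HasSubst.X_zero]
      rw [this]
      exact F.add_zero (PowerSeries.HasSubst.X 0)
    · simp [subst_X HasSubst.X_zero]
  rw [map_sub, ← coeff_subst_t_zero _ m hm, key, coeff_subst_t_zero _ m hm, sub_self]

open MvPowerSeries in
theorem eq_zero_of_X_one_pow_dvd (f : MvPowerSeries (Fin 2) R)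
    (h : ∀ n : ℕ, (X 1 : MvPowerSeries (Fin 2) R) ^ n ∣ f) : f = 0 := by
  ext m
  simpa using X_pow_dvd_iff.1 (h (m 1 + 1)) m (Nat.lt_succ_self _)

open MvPowerSeries in
theorem shift_bijective (F : FormalGroup R) : Function.Bijective (shift F) := by
  choose N hN using X_one_dvd_shift_sub F
  constructor
  · rw [injective_iff_map_eq_zero]
    intro f hf
    refine eq_zero_of_X_one_pow_dvd f fun n => ?_
    induction n with
    | zero => simp
    | succ n ih =>
      obtain ⟨g, rfl⟩ := ih
      have h1 : (X 1 : MvPowerSeries (Fin 2) R) ^ n * shift F g = X 1 ^ n * 0 := by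
        rw [map_mul, map_pow, shift_X_one] at hf
        rw [hf, mul_zero]
      have h2 : shift F g = 0 :=
        (mul_cancel_left_mem_nonZeroDivisors
          (pow_mem (X_mem_nonzeroDivisors (R := R) (i := (1 : Fin 2))) n)).1 h1
      have h3 := hN g
      rw [h2, zero_sub] at h3
      rw [pow_succ]
      exact mul_dvd_mul_left _ ⟨-N g, by rw [mul_neg, ← h3, neg_neg]⟩
  · intro g
    let a : ℕ → MvPowerSeries (Fin 2) R := fun n => (fun h => -N h)^[n] g
    have ha : ∀ n, shift F (a n) = a n - X 1 * a (n + 1) := fun n => by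
      have h1 : a (n + 1) = -N (a n) := Function.iterate_succ_apply' _ _ _
      rw [h1, mul_neg, sub_neg_eq_add, ← hN, add_sub_cancel]
    let f : MvPowerSeries (Fin 2) R := fun m =>
      ∑ k ∈ Finset.range (m 1 + 1), coeff m ((X 1 : MvPowerSeries (Fin 2) R) ^ k * a k)
    have hf : ∀ n : ℕ, (X 1 : MvPowerSeries (Fin 2) R) ^ n ∣
        f - ∑ k ∈ Finset.range n, X 1 ^ k * a k := fun n => by
      rw [X_pow_dvd_iff]
      intro m hm
      rw [map_sub, map_sum, sub_eq_zero]
      change ∑ k ∈ Finset.range (m 1 + 1), coeff m ((X 1 : MvPowerSeries (Fin 2) R) ^ k * a k) = _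
      refine Finset.sum_subset (Finset.range_mono hm) fun k _ hk => ?_
      exact X_pow_dvd_iff.1 (dvd_mul_right (X 1 ^ k) (a k)) m (by simpa using hk)
    have hs : ∀ n : ℕ, shift F (∑ k ∈ Finset.range n, X 1 ^ k * a k) = g - X 1 ^ n * a n :=
      fun n => by
      induction n with
      | zero => simp [a]
      | succ n ih =>
        rw [Finset.sum_range_succ, map_add, ih, map_mul, map_pow, shift_X_one, ha]
        ring
    refine ⟨f, sub_eq_zero.1 (eq_zero_of_X_one_pow_dvd _ fun n => ?_)⟩
    obtain ⟨h, hh⟩ := hf n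
    refine ⟨shift F h - a n, ?_⟩
    rw [sub_eq_iff_eq_add.1 hh, map_add, hs, map_mul, map_pow, shift_X_one]
    ring

/-- The automorphism `f(y, t) ↦ f(F(y, t), t)` of `R⟦y, t⟧`. -/
def shiftEquiv (F : FormalGroup R) : RingAut (MvPowerSeries (Fin 2) R) :=
  RingEquiv.ofBijective (shift F) (shift_bijective F)

/-- A copy of `R⟦y, t⟧`, on which `n : ℤ` acts by the `(-n)`-th power of `shiftEquiv F`. -/
def Coeff (_F : FormalGroup R) := MvPowerSeries (Fin 2) R

instance (F : FormalGroup R) : CommRing (Coeff F) :=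
  inferInstanceAs (CommRing (MvPowerSeries (Fin 2) R))

instance (F : FormalGroup R) : Algebra (PowerSeries R) (Coeff F) :=
  inferInstanceAs (Algebra (PowerSeries R) (MvPowerSeries (Fin 2) R))

/-- The identity map `R⟦y, t⟧ → Coeff F`. -/
def toCoeff (F : FormalGroup R) : MvPowerSeries (Fin 2) R ≃ₐ[PowerSeries R] Coeff F :=
  AlgEquiv.refl

instance (F : FormalGroup R) : MulSemiringAction (Multiplicative ℤ) (Coeff F) :=
  MulSemiringAction.compHom (MvPowerSeries (Fin 2) R)
    (zpowersHom (RingAut (MvPowerSeries (Fin 2) R)) (shiftEquiv F)⁻¹)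

theorem smul_coeff (F : FormalGroup R) (n : ℤ) (f : MvPowerSeries (Fin 2) R) :
    Multiplicative.ofAdd n • toCoeff F f = toCoeff F (((shiftEquiv F)⁻¹ ^ n) f) := rfl

instance (F : FormalGroup R) : SMulCommClass (Multiplicative ℤ) (PowerSeries R) (Coeff F) where
  smul_comm n r f := by
    have h1 : shiftEquiv F ∈ MulAction.stabilizer (RingAut (MvPowerSeries (Fin 2) R))
        (algebraMap (PowerSeries R) (MvPowerSeries (Fin 2) R) r) := shift_algebraMapT F r
    have h2 : n • (algebraMap (PowerSeries R) (Coeff F) r) = algebraMap (PowerSeries R) (Coeff F) r :=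
      zpow_mem (inv_mem h1) n.toAdd
    rw [Algebra.smul_def, Algebra.smul_def, smul_mul', h2]

/-- The `F`-Weyl algebra of `𝔾ₘ`: the skew Laurent polynomial ring `R⟦y, t⟧[x, x⁻¹]` with
`f(y, t) x = x f(F(y, t), t)`. The element `single (ofAdd n) f` is `f xⁿ`. -/
abbrev Weyl (F : FormalGroup R) : Type _ := SkewMonoidAlgebra (Coeff F) (Multiplicative ℤ)

/-- The power `xⁿ`, `n ∈ ℤ`, in the `F`-Weyl algebra. -/
def xPow (F : FormalGroup R) (n : ℤ) : Weyl F :=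
  SkewMonoidAlgebra.single (Multiplicative.ofAdd n) 1

/-- A power series in `y` and `t` as an element of the `F`-Weyl algebra. -/
def ofYT (F : FormalGroup R) (f : MvPowerSeries (Fin 2) R) : Weyl F :=
  SkewMonoidAlgebra.single 1 (toCoeff F f)

theorem ofYT_mul_x (F : FormalGroup R) (f : MvPowerSeries (Fin 2) R) :
    ofYT F f * xPow F 1 = xPow F 1 * ofYT F (shift F f) := by
  have h : Multiplicative.ofAdd (1 : ℤ) • toCoeff F (shift F f) = toCoeff F f := by
    rw [smul_coeff, zpow_one]
    exact congrArg (toCoeff F) ((shiftEquiv F).symm_apply_apply f)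
  simp [ofYT, xPow, SkewMonoidAlgebra.single_mul_single, h]

/-- The defining relation `y x = x F(y, t)`. -/
theorem y_mul_x (F : FormalGroup R) :
    ofYT F (MvPowerSeries.X 0) * xPow F 1 = xPow F 1 * ofYT F (yAdd F PowerSeries.X) := by
  rw [ofYT_mul_x, shift_X_zero]

theorem xPow_add (F : FormalGroup R) (m n : ℤ) : xPow F (m + n) = xPow F m * xPow F n := by
  simp [xPow, SkewMonoidAlgebra.single_mul_single]

/-- The reduction `D ⊗_{R⟦t⟧} R⟦t⟧/⟨p⟩_F` of the `F`-Weyl algebra `D`. -/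
abbrev WeylMod (F : FormalGroup R) (p : ℕ) : Type _ :=
  Weyl F ⊗[PowerSeries R] (PowerSeries R ⧸ Ideal.span {angle F p})

/-- The ring `R⟦t⟧⟦z⟧[u, u⁻¹]/⟨p⟩_F`; in `R⟦t⟧⟦z⟧ = R⟦z, t⟧` the variable `0` is `z` and the
variable `1` is `t`. -/
abbrev LaurentMod (F : FormalGroup R) (p : ℕ) : Type _ :=
  (MvPowerSeries (Fin 2) R)[T;T⁻¹] ⧸
    Ideal.span {algebraMap (PowerSeries R) (MvPowerSeries (Fin 2) R)[T;T⁻¹] (angle F p)}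

end FWeyl

end

open FWeyl

/-! Write `τ` for the shift `y ↦ y +_F t` and `A` for `⟨p⟩_F`; everything is done modulo `A`. Since
`a +_F b = a + b · unit`, the difference `τ^m y - y` equals `[m]_F = t⟨m⟩_F` times a unit. For `m =
p` it vanishes modulo `A`, so `τ^p ≡ id`. For `m` prime to `p`, `⟨m⟩_F` is a unit modulo `A`
(`isCoprime_angle`) and `t` is a non-zero-divisor, hence so is `τ^m y - y`
(`angleYT_dvd_of_dvd_mul_shiftEquiv_sub`).

Let `∑ fₙ xⁿ` be central. Commuting with `x` makes every `fₙ` invariant under `τ`; commuting with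
`y` gives `fₙ (τ^{-n} y - y) ≡ 0`, so `fₙ ≡ 0` unless `p ∣ n`. Conversely, invariant coefficients of
powers of `x^p` are central because `τ^p ≡ id`.

It remains to find the invariants. The norm `z_F` is congruent to `y^p` modulo `t`, so by
Weierstrass division `R⟦y, t⟧` is free over `R⟦z_F, t⟧` on `1, y, …, y^(p-1)`
(`substPow_bijective`). Applying `τ^j`, `j < p`, to `f = ∑ y^i gᵢ(z_F)` with `f` invariant gives a
Vandermonde system in the conjugates of `y`. Its determinant is a non-zero-divisor, which forces `f
≡ g₀(z_F)` (`exists_angleYT_dvd_sub_substY`). Freeness also shows that `A ∣ g(z_F)` only if `A ∣ g`,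
which identifies the kernel of the map (`ker_laurentToWeyl`). -/

noncomputable section

namespace FWeyl

variable {R : Type*} [CommRing R]

/-! ### Power series in `y` with coefficients in `R⟦t⟧` -/

section Slices

open MvPowerSeries

theorem coeff_algebraMapT (a : PowerSeries R) (m : Fin 2 →₀ ℕ) :
    coeff m (algebraMap (PowerSeries R) (MvPowerSeries (Fin 2) R) a) =
      if m 0 = 0 then PowerSeries.coeff (m 1) a else 0 := by
  classical
  change coeff m (PowerSeries.substAlgHom (PowerSeries.HasSubst.X (1 : Fin 2)) a) = _
  rw [PowerSeries.coe_substAlgHom, PowerSeries.coeff_subst (PowerSeries.HasSubst.X (1 : Fin 2)),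
    finsum_eq_single _ (m 1)]
  · rw [coeff_X_pow]
    by_cases h : m 0 = 0
    · rw [if_pos h, if_pos, smul_eq_mul, mul_one]
      ext i
      fin_cases i <;> simp [h]
    · rw [if_neg h, if_neg, smul_zero]
      intro h'
      apply h
      rw [h']
      simp
  · intro d hd
    rw [coeff_X_pow, if_neg, smul_zero]
    intro h
    apply hd
    rw [h]
    simp

/-- The exponent of the monomial `y ^ k * t ^ n`. -/
def expo (k n : ℕ) : Fin 2 →₀ ℕ := Finsupp.single 0 k + Finsupp.single 1 n

@[simp] theorem expo_zero (k n : ℕ) : expo k n 0 = k := by simp [expo]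

@[simp] theorem expo_one (k n : ℕ) : expo k n 1 = n := by simp [expo]

theorem expo_eta (m : Fin 2 →₀ ℕ) : expo (m 0) (m 1) = m := by
  ext i
  fin_cases i <;> simp

/-- The coefficient of `y ^ k` of a power series in `y` and `t`, as a power series in `t`. -/
def slice (k : ℕ) (f : MvPowerSeries (Fin 2) R) : PowerSeries R :=
  PowerSeries.mk fun n => coeff (expo k n) f

@[simp] theorem coeff_slice (k n : ℕ) (f : MvPowerSeries (Fin 2) R) :
    PowerSeries.coeff n (slice k f) = coeff (expo k n) f := by
  simp [slice]

/-- The power series in `y` and `t` with prescribed coefficients of the powers of `y`. -/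
def ofSlices (c : ℕ → PowerSeries R) : MvPowerSeries (Fin 2) R :=
  fun m => PowerSeries.coeff (m 1) (c (m 0))

theorem coeff_ofSlices (c : ℕ → PowerSeries R) (m : Fin 2 →₀ ℕ) :
    coeff m (ofSlices c) = PowerSeries.coeff (m 1) (c (m 0)) := rfl

@[simp] theorem slice_ofSlices (c : ℕ → PowerSeries R) (k : ℕ) : slice k (ofSlices c) = c k := by
  ext n
  simp [coeff_ofSlices]

theorem slice_ext {f g : MvPowerSeries (Fin 2) R} (h : ∀ k, slice k f = slice k g) : f = g := by
  ext m
  rw [← expo_eta m, ← coeff_slice, h, coeff_slice]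

@[simp] theorem slice_add (k : ℕ) (f g : MvPowerSeries (Fin 2) R) :
    slice k (f + g) = slice k f + slice k g := by
  ext n
  simp

@[simp] theorem slice_zero (k : ℕ) : slice k (0 : MvPowerSeries (Fin 2) R) = 0 := by
  ext n
  simp

theorem slice_sum {ι : Type*} (s : Finset ι) (k : ℕ) (f : ι → MvPowerSeries (Fin 2) R) :
    slice k (∑ i ∈ s, f i) = ∑ i ∈ s, slice k (f i) := by
  ext n
  simp

@[simp] theorem slice_smul (k : ℕ) (a : PowerSeries R) (f : MvPowerSeries (Fin 2) R) :
    slice k (a • f) = a * slice k f := by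
  classical
  ext n
  rw [Algebra.smul_def, coeff_slice, coeff_mul, PowerSeries.coeff_mul]
  symm
  -- A series in `t` has no `y`, so only splittings that give the whole `y`-exponent to `f`
  -- contribute.
  refine Finset.sum_of_injOn (fun q => (expo 0 q.1, expo k q.2)) ?_ ?_ ?_ ?_
  · intro q _ q' _ h
    have h1 := DFunLike.congr_fun (congrArg Prod.fst h) 1
    have h2 := DFunLike.congr_fun (congrArg Prod.snd h) 1
    simp only [expo_one] at h1 h2
    exact Prod.ext h1 h2
  · intro q hq
    have hq' := Finset.HasAntidiagonal.mem_antidiagonal.1 hq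
    refine Finset.HasAntidiagonal.mem_antidiagonal.2 ?_
    ext i
    fin_cases i <;> simp [← hq']
  · rintro ⟨u, v⟩ hq hn
    have hq' := Finset.HasAntidiagonal.mem_antidiagonal.1 hq
    have h0 := DFunLike.congr_fun hq' 0
    have h1 := DFunLike.congr_fun hq' 1
    simp only [Finsupp.add_apply, expo_zero, expo_one] at h0 h1
    rw [coeff_algebraMapT, if_neg, zero_mul]
    intro hu
    refine hn ⟨(u 1, v 1), by simpa using h1, ?_⟩
    have h0' : v 0 = k := by rwa [hu, zero_add] at h0
    refine Prod.ext ?_ ?_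
    · simpa [hu] using expo_eta u
    · simpa [h0'] using expo_eta v
  · intro q _
    simp [coeff_algebraMapT]

/-- A series in `t` multiplies each coefficient of `y ^ k` separately, and quotients chosen for each
`k` assemble without any convergence condition. This transfers divisibility questions to `R⟦t⟧`. -/
theorem algebraMap_dvd_iff (a : PowerSeries R) (f : MvPowerSeries (Fin 2) R) :
    algebraMap (PowerSeries R) (MvPowerSeries (Fin 2) R) a ∣ f ↔ ∀ k, a ∣ slice k f := by
  constructor
  · rintro ⟨g, rfl⟩ k
    rw [← Algebra.smul_def, slice_smul]
    exact dvd_mul_right _ _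
  · intro h
    choose c hc using h
    refine ⟨ofSlices c, slice_ext fun k => ?_⟩
    rw [← Algebra.smul_def, slice_smul, slice_ofSlices, hc]

/-- The map taking `∑ cₖ y ^ k` to `∑ c_{pk+i} y ^ k`. -/
def progression (p i : ℕ) : MvPowerSeries (Fin 2) R →ₗ[PowerSeries R] MvPowerSeries (Fin 2) R where
  toFun f := ofSlices fun k => slice (p * k + i) f
  map_add' f g := slice_ext fun k => by simp
  map_smul' a f := slice_ext fun k => by simp

@[simp] theorem slice_progression (p i k : ℕ) (f : MvPowerSeries (Fin 2) R) :
    slice k (progression p i f) = slice (p * k + i) f := by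
  simp [progression]

theorem slice_X_zero_pow_mul (i k : ℕ) (f : MvPowerSeries (Fin 2) R) :
    slice k (X 0 ^ i * f) = if i ≤ k then slice (k - i) f else 0 := by
  classical
  ext n
  rw [coeff_slice, X_pow_eq, coeff_monomial_mul]
  by_cases h : i ≤ k
  · rw [if_pos h, if_pos, one_mul, coeff_slice]
    · congr 2
      ext j
      fin_cases j <;> simp
    · intro j
      fin_cases j <;> simp [h]
  · rw [if_neg h, if_neg, map_zero]
    intro h'
    exact h (by simpa using h' 0)

end Slices

/-! ### Substitution for `y` and Weierstrass division -/

section Subst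

open MvPowerSeries

variable {w : MvPowerSeries (Fin 2) R}

theorem hasSubst_pair (hw : constantCoeff w = 0) : HasSubst ![w, (X 1 : MvPowerSeries (Fin 2) R)] := by
  refine hasSubst_of_constantCoeff_zero fun s => ?_
  fin_cases s
  · exact hw
  · simp

theorem subst_algebraMapT {a : Fin 2 → MvPowerSeries (Fin 2) R} (ha : HasSubst a)
    (h1 : a 1 = X 1) (f : PowerSeries R) :
    subst a (algebraMap (PowerSeries R) (MvPowerSeries (Fin 2) R) f) = algebraMap _ _ f := by
  change subst a (PowerSeries.substAlgHom (PowerSeries.HasSubst.X (1 : Fin 2)) f) =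
    PowerSeries.substAlgHom (PowerSeries.HasSubst.X (1 : Fin 2)) f
  rw [PowerSeries.coe_substAlgHom, PowerSeries.subst,
    subst_comp_subst_apply (PowerSeries.HasSubst.X (1 : Fin 2)).const ha]
  simp [subst_X ha, h1]

/-- The `R⟦t⟧`-algebra map `g(y, t) ↦ g(w, t)`. -/
def substY (hw : constantCoeff w = 0) : MvPowerSeries (Fin 2) R →ₐ[PowerSeries R] MvPowerSeries (Fin 2) R where
  __ := (substAlgHom (hasSubst_pair hw) : MvPowerSeries (Fin 2) R →ₐ[R] MvPowerSeries (Fin 2) R)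
  commutes' f := by
    change substAlgHom (hasSubst_pair hw) _ = _
    rw [substAlgHom_apply]
    exact subst_algebraMapT (hasSubst_pair hw) rfl f

theorem substY_apply (hw : constantCoeff w = 0) (f : MvPowerSeries (Fin 2) R) : substY hw f = subst ![w, X 1] f :=
  substAlgHom_apply (hasSubst_pair hw) f

/-- Setting one variable to zero keeps exactly the monomials that do not involve it. -/
theorem X_dvd_of_subst_eq_zero {σ : Type*} [Finite σ] [DecidableEq σ] (i : σ)
    (f : MvPowerSeries σ R)
    (h : subst (fun s => if s = i then 0 else (X s : MvPowerSeries σ R)) f = 0) : X i ∣ f := by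
  have hs : HasSubst (fun s => if s = i then 0 else (X s : MvPowerSeries σ R)) :=
    hasSubst_of_constantCoeff_zero fun s => by split_ifs <;> simp
  rw [X_dvd_iff]
  intro m hm
  have h1 := congrArg (coeff m) h
  rw [coeff_subst hs, finsum_eq_single _ m, map_zero] at h1
  · have : (m.prod fun s e => (if s = i then 0 else (X s : MvPowerSeries σ R)) ^ e) =
        monomial m 1 := by
      rw [monomial_one_eq]
      refine Finsupp.prod_congr fun s hs' => ?_
      rw [if_neg]
      rintro rfl
      exact Finsupp.mem_support_iff.1 hs' hm
    rw [this, coeff_monomial_same, smul_eq_mul, mul_one] at h1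
    exact h1
  · intro d hd
    by_cases hi : d i = 0
    · have : (d.prod fun s e => (if s = i then 0 else (X s : MvPowerSeries σ R)) ^ e) =
          monomial d 1 := by
        rw [monomial_one_eq]
        refine Finsupp.prod_congr fun s hs' => ?_
        rw [if_neg]
        rintro rfl
        exact Finsupp.mem_support_iff.1 hs' hi
      rw [this, coeff_monomial, if_neg hd.symm, smul_zero]
    · have : (d.prod fun s e => (if s = i then 0 else (X s : MvPowerSeries σ R)) ^ e) = 0 := by
        refine Finset.prod_eq_zero (i := i) (by simpa using hi) ?_
        simp [hi]
      rw [this, map_zero, smul_zero]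

/-- The universal case is `v ∣ f(u + v, c) - f(u, c)` in three variables, seen by setting `v = 0`;
then specialize to `u = b`, `v = a - b`. -/
theorem sub_dvd_subst_sub {τ : Type*} {a b c : MvPowerSeries τ R} (ha : constantCoeff a = 0)
    (hb : constantCoeff b = 0) (hc : constantCoeff c = 0) (f : MvPowerSeries (Fin 2) R) :
    a - b ∣ subst ![a, c] f - subst ![b, c] f := by
  have h1 : HasSubst ![X 0 + X 1, (X 2 : MvPowerSeries (Fin 3) R)] :=
    hasSubst_of_constantCoeff_zero fun s => by fin_cases s <;> simp
  have h2 : HasSubst ![X 0, (X 2 : MvPowerSeries (Fin 3) R)] :=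
    hasSubst_of_constantCoeff_zero fun s => by fin_cases s <;> simp
  have h3 : HasSubst (fun s : Fin 3 => if s = 1 then 0 else (X s : MvPowerSeries (Fin 3) R)) :=
    hasSubst_of_constantCoeff_zero fun s => by split_ifs <;> simp
  have h4 : HasSubst ![b, a - b, c] :=
    hasSubst_of_constantCoeff_zero fun s => by fin_cases s <;> simp [ha, hb, hc]
  have key : (X 1 : MvPowerSeries (Fin 3) R) ∣
      subst ![X 0 + X 1, (X 2 : MvPowerSeries (Fin 3) R)] f -
        subst ![X 0, (X 2 : MvPowerSeries (Fin 3) R)] f := by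
    refine X_dvd_of_subst_eq_zero 1 _ ?_
    rw [subst_sub h3, subst_comp_subst_apply h1 h3, subst_comp_subst_apply h2 h3, sub_eq_zero]
    congr 1
    funext s
    fin_cases s <;> simp [subst_add h3, subst_X h3]
  have := map_dvd (substAlgHom (R := R) h4) key
  rw [map_sub, substAlgHom_apply, substAlgHom_apply, substAlgHom_apply, subst_X h4,
    subst_comp_subst_apply h1 h4, subst_comp_subst_apply h2 h4] at this
  have h5 : (fun s => subst ![b, a - b, c]
      ((![X 0 + X 1, X 2] : Fin 2 → MvPowerSeries (Fin 3) R) s)) = ![a, c] := by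
    funext s
    fin_cases s <;> simp [subst_add h4, subst_X h4]
  have h6 : (fun s => subst ![b, a - b, c]
      ((![X 0, X 2] : Fin 2 → MvPowerSeries (Fin 3) R) s)) = ![b, c] := by
    funext s
    fin_cases s <;> simp [subst_X h4]
  rwa [h5, h6] at this

theorem slice_subst_X_pow {p : ℕ} (hp : p ≠ 0) (k : ℕ) (g : MvPowerSeries (Fin 2) R) :
    slice k (subst ![X 0 ^ p, (X 1 : MvPowerSeries (Fin 2) R)] g) =
      if p ∣ k then slice (k / p) g else 0 := by
  classical
  have hs : HasSubst ![X 0 ^ p, (X 1 : MvPowerSeries (Fin 2) R)] :=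
    hasSubst_pair (by simp [hp])
  have hm : ∀ d : Fin 2 →₀ ℕ, (d.prod fun s e =>
      (![X 0 ^ p, (X 1 : MvPowerSeries (Fin 2) R)] s) ^ e) = monomial (expo (p * d 0) (d 1)) 1 := by
    intro d
    rw [Finsupp.prod_fintype _ _ (by simp), Fin.prod_univ_two]
    simp only [Matrix.cons_val_zero, Matrix.cons_val_one]
    rw [← pow_mul, X_pow_eq, X_pow_eq, monomial_mul_monomial, one_mul, expo]
  ext n
  rw [coeff_slice, coeff_subst hs]
  simp only [hm, coeff_monomial, smul_eq_mul, mul_ite, mul_one, mul_zero]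
  split_ifs with h
  · obtain ⟨l, rfl⟩ := h
    rw [Nat.mul_div_cancel_left _ (Nat.pos_of_ne_zero hp), finsum_eq_single _ (expo l n)]
    · simp
    · intro d hd
      rw [if_neg]
      intro h
      apply hd
      have h0 := DFunLike.congr_fun h 0
      have h1 := DFunLike.congr_fun h 1
      simp only [expo_zero, expo_one] at h0 h1
      rw [← expo_eta d, h1, Nat.eq_of_mul_eq_mul_left (Nat.pos_of_ne_zero hp) h0]
  · rw [map_zero]
    refine finsum_eq_zero_of_forall_eq_zero fun d => ?_
    rw [if_neg]
    intro h'
    have h0 := DFunLike.congr_fun h' 0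
    simp only [expo_zero] at h0
    exact h ⟨_, h0⟩

theorem sum_X_pow_mul_progression {p : ℕ} (hp : p ≠ 0) (f : MvPowerSeries (Fin 2) R) :
    ∑ i ∈ Finset.range p,
      X 0 ^ i * subst ![X 0 ^ p, (X 1 : MvPowerSeries (Fin 2) R)] (progression p i f) = f := by
  refine slice_ext fun k => ?_
  rw [slice_sum, Finset.sum_eq_single (k % p)]
  · rw [slice_X_zero_pow_mul, if_pos (Nat.mod_le _ _), slice_subst_X_pow hp,
      if_pos (Nat.dvd_sub_mod k), slice_progression]
    congr 1
    rw [Nat.mul_div_cancel' (Nat.dvd_sub_mod k), Nat.sub_add_cancel (Nat.mod_le _ _)]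
  · intro i hi hik
    rw [slice_X_zero_pow_mul]
    split_ifs with h
    · rw [slice_subst_X_pow hp, if_neg]
      intro hd
      apply hik
      rw [← Nat.mod_eq_of_lt (Finset.mem_range.1 hi)]
      exact (Nat.modEq_iff_dvd' h).2 hd
    · rfl
  · intro h
    exact absurd (Finset.mem_range.2 (Nat.mod_lt _ (Nat.pos_of_ne_zero hp))) h

/-- A perturbation of the identity by multiples of `t` is inverted by a `t`-adic geometric series.
-/
theorem bijective_of_X_one_dvd_sub
    (φ : MvPowerSeries (Fin 2) R →ₗ[PowerSeries R] MvPowerSeries (Fin 2) R)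
    (hφ : ∀ f, X 1 ∣ φ f - f) : Function.Bijective φ := by
  choose N hN using hφ
  have hX : ∀ (n : ℕ) (f : MvPowerSeries (Fin 2) R), φ (X 1 ^ n * f) = X 1 ^ n * φ f := by
    intro n f
    have := φ.map_smul (PowerSeries.X ^ n) f
    rwa [Algebra.smul_def, Algebra.smul_def, map_pow, algebraMapT_X] at this
  constructor
  · rw [injective_iff_map_eq_zero]
    intro f hf
    refine eq_zero_of_X_one_pow_dvd f fun n => ?_
    induction n with
    | zero => simp
    | succ n ih =>
      obtain ⟨g, rfl⟩ := ih
      have h1 : (X 1 : MvPowerSeries (Fin 2) R) ^ n * φ g = X 1 ^ n * 0 := by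
        rw [← hX, hf, mul_zero]
      have h2 : φ g = 0 :=
        (mul_cancel_left_mem_nonZeroDivisors
          (pow_mem (X_mem_nonzeroDivisors (R := R) (i := (1 : Fin 2))) n)).1 h1
      have h3 := hN g
      rw [h2, zero_sub] at h3
      rw [pow_succ]
      exact mul_dvd_mul_left _ ⟨-N g, by rw [mul_neg, ← h3, neg_neg]⟩
  · intro g
    -- These satisfy `φ (a n) = a n - t * a (n + 1)`, so `φ` of the partial sums of `∑ t ^ k * a k`
    -- telescopes to `g` up to `t ^ n`.
    let a : ℕ → MvPowerSeries (Fin 2) R := fun n => (fun h => -N h)^[n] g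
    have ha : ∀ n, φ (a n) = a n - X 1 * a (n + 1) := fun n => by
      have h1 : a (n + 1) = -N (a n) := Function.iterate_succ_apply' _ _ _
      rw [h1, mul_neg, sub_neg_eq_add, ← hN, add_sub_cancel]
    -- The infinite sum `∑ t ^ k * a k`: terms with `k > m 1` do not affect the coefficient at `m`.
    let f : MvPowerSeries (Fin 2) R := fun m =>
      ∑ k ∈ Finset.range (m 1 + 1), coeff m ((X 1 : MvPowerSeries (Fin 2) R) ^ k * a k)
    have hf : ∀ n : ℕ, (X 1 : MvPowerSeries (Fin 2) R) ^ n ∣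
        f - ∑ k ∈ Finset.range n, X 1 ^ k * a k := fun n => by
      rw [X_pow_dvd_iff]
      intro m hm
      rw [map_sub, map_sum, sub_eq_zero]
      change ∑ k ∈ Finset.range (m 1 + 1), coeff m ((X 1 : MvPowerSeries (Fin 2) R) ^ k * a k) = _
      refine Finset.sum_subset (Finset.range_mono hm) fun k _ hk => ?_
      exact X_pow_dvd_iff.1 (dvd_mul_right (X 1 ^ k) (a k)) m (by simpa using hk)
    have hs : ∀ n : ℕ, φ (∑ k ∈ Finset.range n, X 1 ^ k * a k) = g - X 1 ^ n * a n :=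
      fun n => by
      induction n with
      | zero => simp [a]
      | succ n ih =>
        rw [Finset.sum_range_succ, map_add, ih, hX, ha]
        ring
    refine ⟨f, sub_eq_zero.1 (eq_zero_of_X_one_pow_dvd _ fun n => ?_)⟩
    obtain ⟨h, hh⟩ := hf n
    refine ⟨φ h - a n, ?_⟩
    rw [sub_eq_iff_eq_add.1 hh, map_add, hs, hX]
    ring

variable {p : ℕ}

/-- The `R⟦t⟧`-linear map `∑ y ^ i * gᵢ(y ^ p, t) ↦ ∑ y ^ i * gᵢ(w, t)`, where `i < p`. -/
def substPow (hw : constantCoeff w = 0) (p : ℕ) : MvPowerSeries (Fin 2) R →ₗ[PowerSeries R] MvPowerSeries (Fin 2) R :=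
  ∑ i ∈ Finset.range p, LinearMap.mulLeft (PowerSeries R) (X 0 ^ i) ∘ₗ
    (substY hw).toLinearMap ∘ₗ progression p i

theorem substPow_apply (hw : constantCoeff w = 0) (p : ℕ) (f : MvPowerSeries (Fin 2) R) :
    substPow hw p f = ∑ i ∈ Finset.range p, X 0 ^ i * substY hw (progression p i f) := by
  simp [substPow]

/-- With `y ^ p` in place of `w` the map is the identity, by sorting exponents modulo `p`; replacing
`y ^ p` by `w` changes it only by multiples of `w - y ^ p`, hence of `t`. -/
theorem substPow_bijective (hw : constantCoeff w = 0) (hp : p ≠ 0) (hwp : X 1 ∣ w - X 0 ^ p) :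
    Function.Bijective (substPow hw p) := by
  refine bijective_of_X_one_dvd_sub _ fun f => ?_
  nth_rw 2 [← sum_X_pow_mul_progression hp f]
  rw [substPow_apply, ← Finset.sum_sub_distrib]
  refine Finset.dvd_sum fun i _ => ?_
  rw [← mul_sub, substY_apply]
  exact (hwp.trans (sub_dvd_subst_sub hw (by simp [hp]) (by simp) _)).mul_left _

/-- Weierstrass division: `1, y, …, y ^ (p - 1)` generate `R⟦y, t⟧` over `R⟦w, t⟧` when `w` is
congruent to `y ^ p` modulo `t`. -/
theorem exists_eq_sum_X_pow_mul_substY (hw : constantCoeff w = 0) (hp : p ≠ 0) (hwp : X 1 ∣ w - X 0 ^ p)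
    (f : MvPowerSeries (Fin 2) R) :
    ∃ g : ℕ → MvPowerSeries (Fin 2) R, f = ∑ i ∈ Finset.range p, X 0 ^ i * substY hw (g i) := by
  obtain ⟨f', rfl⟩ := (substPow_bijective hw hp hwp).2 f
  exact ⟨fun i => progression p i f', substPow_apply hw p f'⟩

theorem progression_subst_X_pow {i : ℕ} (hi : i < p) (g : MvPowerSeries (Fin 2) R) :
    progression p i (subst ![X 0 ^ p, (X 1 : MvPowerSeries (Fin 2) R)] g) =
      if i = 0 then g else 0 := by
  have hp : 0 < p := by omega
  refine slice_ext fun k => ?_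
  rw [slice_progression, slice_subst_X_pow hp.ne']
  split_ifs with h1 h2 h2
  · rw [h2, add_zero, Nat.mul_div_cancel_left _ hp]
  · have := (Nat.dvd_add_right (Dvd.intro k rfl)).1 h1
    exact absurd (Nat.eq_zero_of_dvd_of_lt this hi) h2
  · exact absurd (by rw [h2, add_zero]; exact dvd_mul_right p k) h1
  · simp

/-- `g(w, t)` is the image of `g(y ^ p, t)` under the `R⟦t⟧`-linear bijection `substPow`, so a
factor `a` pulls back to `g(y ^ p, t)`, and then to `g` by taking the exponents divisible by `p`. -/
theorem algebraMap_dvd_of_dvd_substY (hw : constantCoeff w = 0) (hp : p ≠ 0) (hwp : X 1 ∣ w - X 0 ^ p)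
    (a : PowerSeries R) (g : MvPowerSeries (Fin 2) R)
    (h : algebraMap (PowerSeries R) (MvPowerSeries (Fin 2) R) a ∣ substY hw g) :
    algebraMap (PowerSeries R) (MvPowerSeries (Fin 2) R) a ∣ g := by
  obtain ⟨q, hq⟩ := h
  obtain ⟨q', rfl⟩ := (substPow_bijective hw hp hwp).2 q
  have h0 : 0 < p := Nat.pos_of_ne_zero hp
  have h1 : substPow hw p (subst ![X 0 ^ p, (X 1 : MvPowerSeries (Fin 2) R)] g) =
      substY hw g := by
    rw [substPow_apply, Finset.sum_eq_single 0]
    · rw [progression_subst_X_pow h0, if_pos rfl, pow_zero, one_mul]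
    · intro i hi hi0
      rw [progression_subst_X_pow (Finset.mem_range.1 hi), if_neg hi0, map_zero, mul_zero]
    · intro h
      exact absurd (Finset.mem_range.2 h0) h
  rw [← Algebra.smul_def, ← map_smul, ← h1] at hq
  have h2 := congrArg (progression p 0) ((substPow_bijective hw hp hwp).1 hq)
  rw [progression_subst_X_pow h0, if_pos rfl, map_smul, Algebra.smul_def] at h2
  exact ⟨_, h2⟩

end Subst

/-! ### Congruences under powers of an automorphism -/

section Automorphism

variable {S : Type*} [CommRing S]

theorem zpow_apply_eq_self {τ : RingAut S} {a : S} (ha : τ a = a) (n : ℤ) : (τ ^ n) a = a :=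
  zpow_mem (show τ ∈ MulAction.stabilizer (RingAut S) a from ha) n

theorem dvd_zpow_apply {τ : RingAut S} {a f : S} (ha : τ a = a) (h : a ∣ f) (n : ℤ) :
    a ∣ (τ ^ n) f := by
  simpa [zpow_apply_eq_self ha n] using map_dvd (τ ^ n) h

theorem dvd_zpow_apply_iff {τ : RingAut S} {a f : S} (ha : τ a = a) (n : ℤ) :
    a ∣ (τ ^ n) f ↔ a ∣ f := by
  refine ⟨fun h => ?_, fun h => dvd_zpow_apply ha h n⟩
  have := dvd_zpow_apply ha h (-n)
  rwa [← RingAut.mul_apply, ← zpow_add, neg_add_cancel, zpow_zero, RingAut.one_apply] at this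

theorem dvd_zpow_apply_sub {τ : RingAut S} {a f : S} (ha : τ a = a) (h : a ∣ τ f - f) (n : ℤ) :
    a ∣ (τ ^ n) f - f := by
  have step : ∀ k : ℤ, a ∣ (τ ^ (k + 1)) f - (τ ^ k) f := fun k => by
    have := dvd_zpow_apply ha h k
    rwa [map_sub, ← RingAut.mul_apply, ← zpow_add_one] at this
  induction n using Int.induction_on with
  | zero => simp
  | succ k ih => simpa using dvd_add (step k) ih
  | pred k ih =>
    have := step (-(k : ℤ) - 1)
    rw [sub_add_cancel] at this
    simpa using dvd_sub ih this

end Automorphism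

/-! ### The formal group law, the `n`-series and iterated shifts -/

section FormalGroup

open MvPowerSeries

variable (F : FormalGroup R)

theorem constantCoeff_subst_eq {σ τ : Type*} [Finite σ] {a : σ → MvPowerSeries τ R}
    (ha : ∀ i, constantCoeff (a i) = 0) (f : MvPowerSeries σ R) :
    constantCoeff (subst a f) = constantCoeff f := by
  have hs := hasSubst_of_constantCoeff_zero ha
  have h := constantCoeff_subst_eq_zero hs ha
    (f := f - C (constantCoeff f)) (by simp)
  rwa [subst_sub hs, subst_C, map_sub, constantCoeff_C, sub_eq_zero] at h

/-- `F(x, 0) = x` makes the second variable divide `F - x`, and its linear coefficient `1` is the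
constant term of the quotient. -/
theorem exists_eq_X_add_X_mul : ∃ U : MvPowerSeries (Fin 2) R, constantCoeff U = 1 ∧
    F.toPowerSeries = X 0 + X 1 * U := by
  have hs : HasSubst (fun s : Fin 2 => if s = 1 then 0 else (X s : MvPowerSeries (Fin 2) R)) :=
    hasSubst_of_constantCoeff_zero fun s => by split_ifs <;> simp
  obtain ⟨U, hU⟩ : (X 1 : MvPowerSeries (Fin 2) R) ∣ F.toPowerSeries - X 0 := by
    refine X_dvd_of_subst_eq_zero 1 _ ?_
    have : (fun s : Fin 2 => if s = 1 then 0 else (X s : MvPowerSeries (Fin 2) R)) = ![X 0, 0] := by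
      funext s
      fin_cases s <;> simp
    rw [subst_sub hs, subst_X hs, this, F.add_zero (PowerSeries.HasSubst.X 0)]
    simp
  refine ⟨U, ?_, by rw [← hU, add_sub_cancel]⟩
  have h := congrArg (coeff (Finsupp.single 1 1)) hU
  rw [map_sub, F.lin_coeff_Y, coeff_X, if_neg, sub_zero, ← pow_one (X 1), X_pow_eq] at h
  · have h2 := coeff_add_monomial_mul (Finsupp.single (1 : Fin 2) 1) 0 U (1 : R)
    rw [add_zero, one_mul, ← h] at h2
    simpa using h2.symm
  · intro h
    have := DFunLike.congr_fun h 0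
    simp at this

variable {f : PowerSeries R}

theorem constantCoeff_pair {σ : Type*} {a b : MvPowerSeries σ R} (ha : constantCoeff a = 0)
    (hb : constantCoeff b = 0) (i : Fin 2) : constantCoeff (![a, b] i) = 0 := by
  fin_cases i
  · exact ha
  · exact hb

theorem hasSubst_cons {σ : Type*} {a b : MvPowerSeries σ R} (ha : constantCoeff a = 0)
    (hb : constantCoeff b = 0) : HasSubst ![a, b] :=
  hasSubst_of_constantCoeff_zero (constantCoeff_pair ha hb)

theorem exists_subst_eq_add_mul {σ : Type*} {a b : MvPowerSeries σ R} (ha : constantCoeff a = 0)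
    (hb : constantCoeff b = 0) :
    ∃ V, constantCoeff V = 1 ∧ subst ![a, b] F.toPowerSeries = a + b * V := by
  obtain ⟨U, hU, h⟩ := exists_eq_X_add_X_mul F
  have hs := hasSubst_cons ha hb
  refine ⟨subst ![a, b] U, ?_, ?_⟩
  · rw [constantCoeff_subst_eq (constantCoeff_pair ha hb), hU]
  · rw [h, subst_add hs, subst_mul hs, subst_X hs, subst_X hs]
    rfl

theorem exists_yAdd_eq (hf : PowerSeries.constantCoeff f = 0) :
    ∃ V, IsUnit V ∧ yAdd F f = X 0 + algebraMap (PowerSeries R) (MvPowerSeries (Fin 2) R) f * V := by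
  obtain ⟨V, hV, h⟩ := exists_subst_eq_add_mul F (constantCoeff_X (0 : Fin 2))
    (constantCoeff_algebraMapT f hf)
  exact ⟨V, by rw [isUnit_iff_constantCoeff, hV]; exact isUnit_one, h⟩

theorem constantCoeff_yAdd (hf : PowerSeries.constantCoeff f = 0) :
    constantCoeff (yAdd F f) = 0 := by
  obtain ⟨V, -, h⟩ := exists_yAdd_eq F hf
  simp [h, constantCoeff_algebraMapT f hf]

theorem yAdd_zero : yAdd F 0 = X 0 := by
  obtain ⟨V, -, h⟩ := exists_yAdd_eq F (f := 0) (map_zero _)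
  simp [h]

theorem angle_zero : angle F 0 = 0 := by
  ext k
  simp [angle, nSeries]

/-- Cancelling `t` in `[n + 1] = t + [n] V` gives `⟨n + 1⟩ = 1 + ⟨n⟩ V` with `V(0) = 1`. -/
theorem constantCoeff_angle (n : ℕ) : PowerSeries.constantCoeff (angle F n) = n := by
  induction n with
  | zero => simp [angle_zero]
  | succ n ih =>
    obtain ⟨V, hV, h⟩ := exists_subst_eq_add_mul F
      (show constantCoeff (PowerSeries.X : PowerSeries R) = 0 from PowerSeries.constantCoeff_X)
      (constantCoeff_nSeries F n)
    have h1 : PowerSeries.X * angle F (n + 1) =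
        PowerSeries.X * (1 + angle F n * (V : PowerSeries R)) := by
      rw [X_mul_angle]
      change subst ![PowerSeries.X, nSeries F n] F.toPowerSeries = _
      rw [h, ← X_mul_angle]
      exact by ring
    rw [PowerSeries.X_mul_cancel h1, map_add, map_one, map_mul, ih,
      show PowerSeries.constantCoeff V = 1 from hV, mul_one, add_comm, Nat.cast_succ]

/-- A Bézout relation for `m` and `n`, applied to these series, yields constant term `1`, hence a
unit of `R⟦t⟧`. -/
theorem isCoprime_angle {m n : ℕ} (h : m.Coprime n) : IsCoprime (angle F m) (angle F n) := by
  obtain ⟨a, b, hab⟩ := Nat.isCoprime_iff_coprime.2 h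
  have hu : IsUnit ((a : PowerSeries R) * angle F m + (b : PowerSeries R) * angle F n) := by
    rw [PowerSeries.isUnit_iff_constantCoeff, map_add, map_mul, map_mul, constantCoeff_angle,
      constantCoeff_angle, map_intCast, map_intCast]
    have : (a : R) * m + b * n = 1 := by exact_mod_cast congrArg (Int.cast : ℤ → R) hab
    rw [this]
    exact isUnit_one
  obtain ⟨w, hw⟩ := hu.exists_left_inv
  exact ⟨w * a, w * b, by rw [← hw]; ring⟩

/-- This is associativity: `(y +_F t) +_F [n] = y +_F (t +_F [n])`. -/
theorem shift_yAdd_nSeries (n : ℕ) :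
    shift F (yAdd F (nSeries F n)) = yAdd F (nSeries F (n + 1)) := by
  have hn := constantCoeff_algebraMapT _ (constantCoeff_nSeries F n)
  have hX : constantCoeff (X 0 : MvPowerSeries (Fin 2) R) = 0 := constantCoeff_X 0
  have h1 : HasSubst ![(PowerSeries.X : PowerSeries R), nSeries F n] :=
    hasSubst_cons (show constantCoeff (PowerSeries.X : PowerSeries R) = 0 from
      PowerSeries.constantCoeff_X) (constantCoeff_nSeries F n)
  have h2 : algebraMap (PowerSeries R) (MvPowerSeries (Fin 2) R) (nSeries F (n + 1)) =
      subst ![X 1, algebraMap (PowerSeries R) (MvPowerSeries (Fin 2) R) (nSeries F n)]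
        F.toPowerSeries := by
    change PowerSeries.substAlgHom (PowerSeries.HasSubst.X (1 : Fin 2))
      (subst ![(PowerSeries.X : PowerSeries R), nSeries F n] F.toPowerSeries) = _
    rw [PowerSeries.coe_substAlgHom, PowerSeries.subst,
      subst_comp_subst_apply h1 (PowerSeries.HasSubst.X (1 : Fin 2)).const]
    congr 1
    funext s
    fin_cases s
    · exact PowerSeries.subst_X (R := R) (PowerSeries.HasSubst.X (1 : Fin 2))
    · change PowerSeries.subst _ (nSeries F n) = PowerSeries.substAlgHom _ (nSeries F n)
      rw [PowerSeries.coe_substAlgHom]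
  have h3 : (fun s => shift F ((![X 0,
      algebraMap (PowerSeries R) (MvPowerSeries (Fin 2) R) (nSeries F n)] : Fin 2 → _) s)) =
      ![yAdd F PowerSeries.X, algebraMap (PowerSeries R) _ (nSeries F n)] := by
    funext s
    fin_cases s
    · exact shift_X_zero F
    · exact shift_algebraMapT F _
  have h4 : shift F (yAdd F (nSeries F n)) =
      subst ![yAdd F PowerSeries.X, algebraMap (PowerSeries R) _ (nSeries F n)]
        F.toPowerSeries := by
    rw [← h3]
    simp only [shift, substAlgHom_apply]
    exact subst_comp_subst_apply (hasSubst_cons hX hn) (hasSubst_shift F) F.toPowerSeries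
  rw [h4, yAdd, yAdd, h2, algebraMapT_X]
  exact F.assoc' (PowerSeries.HasSubst.X 0) (PowerSeries.HasSubst.X 1)
    (PowerSeries.HasSubst.of_constantCoeff_zero hn)

theorem shiftEquiv_pow_X_zero (n : ℕ) : (shiftEquiv F ^ n) (X 0) = yAdd F (nSeries F n) := by
  induction n with
  | zero => simp [nSeries, yAdd_zero]
  | succ n ih =>
    rw [pow_succ', RingAut.mul_apply, ih]
    exact shift_yAdd_nSeries F n

theorem shiftEquiv_pow_apply (n : ℕ) (f : MvPowerSeries (Fin 2) R) :
    (shiftEquiv F ^ n) f = subst ![yAdd F (nSeries F n), X 1] f := by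
  induction n with
  | zero =>
    rw [pow_zero, RingAut.one_apply, nSeries, yAdd_zero]
    have : ![X 0, (X 1 : MvPowerSeries (Fin 2) R)] = X := by
      funext s
      fin_cases s <;> rfl
    rw [this, subst_self, id]
  | succ n ih =>
    rw [pow_succ', RingAut.mul_apply, ih]
    change substAlgHom (hasSubst_shift F) _ = _
    rw [substAlgHom_apply, subst_comp_subst_apply
      (hasSubst_cons (constantCoeff_yAdd F (constantCoeff_nSeries F n)) (constantCoeff_X 1))
      (hasSubst_shift F)]
    congr 1
    funext s
    fin_cases s
    · rw [← shift_yAdd_nSeries, shift, substAlgHom_apply]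
      rfl
    · simp [subst_X (hasSubst_shift F)]

theorem shiftEquiv_algebraMapT (f : PowerSeries R) :
    shiftEquiv F (algebraMap (PowerSeries R) (MvPowerSeries (Fin 2) R) f) = algebraMap _ _ f :=
  shift_algebraMapT F f

end FormalGroup

/-! ### The shift modulo `⟨p⟩_F` and its invariants -/

section Invariants

open MvPowerSeries

variable (F : FormalGroup R) (p : ℕ)

/-- The series `⟨p⟩_F`, as an element of `R⟦y, t⟧`. -/
abbrev angleYT : MvPowerSeries (Fin 2) R :=
  algebraMap (PowerSeries R) (MvPowerSeries (Fin 2) R) (angle F p)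

theorem algebraMapT_nSeries (n : ℕ) :
    algebraMap (PowerSeries R) (MvPowerSeries (Fin 2) R) (nSeries F n) = X 1 * angleYT F n := by
  rw [← X_mul_angle, map_mul, algebraMapT_X]

theorem angleYT_dvd_shiftEquiv_pow_sub (f : MvPowerSeries (Fin 2) R) :
    angleYT F p ∣ (shiftEquiv F ^ p) f - f := by
  obtain ⟨V, -, hV⟩ := exists_yAdd_eq F (constantCoeff_nSeries F p)
  have h := sub_dvd_subst_sub (constantCoeff_yAdd F (constantCoeff_nSeries F p))
    (constantCoeff_X (0 : Fin 2)) (constantCoeff_X (1 : Fin 2)) f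
  rw [← shiftEquiv_pow_apply, show subst ![X 0, X 1] f = f by
    simpa [nSeries, yAdd_zero] using (shiftEquiv_pow_apply F 0 f).symm] at h
  refine Dvd.dvd.trans ⟨X 1 * V, ?_⟩ h
  rw [hV, algebraMapT_nSeries]
  ring

theorem angleYT_dvd_shiftEquiv_zpow_sub {n : ℤ} (hn : (p : ℤ) ∣ n) (f : MvPowerSeries (Fin 2) R) :
    angleYT F p ∣ (shiftEquiv F ^ n) f - f := by
  obtain ⟨m, rfl⟩ := hn
  rw [zpow_mul, zpow_natCast]
  refine dvd_zpow_apply_sub ?_ (angleYT_dvd_shiftEquiv_pow_sub F p f) m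
  exact zpow_natCast (shiftEquiv F) p ▸ zpow_apply_eq_self (shiftEquiv_algebraMapT F _) (p : ℤ)

variable {p}

/-- If `p` is a non-zero-divisor and `⟨p⟩ q = t g`, comparing constant terms gives `p q(0) = 0`, so
`t ∣ q` and `t` cancels. Both alternatives of the hypothesis thus reduce to this one cancellation
property. -/
theorem angle_dvd_of_dvd_X_mul
    (hR : (p : R) ∈ nonZeroDivisors R ∨
      Ideal.Quotient.mk (Ideal.span {angle F p}) (PowerSeries.X : PowerSeries R) ∈
        nonZeroDivisors (PowerSeries R ⧸ Ideal.span {angle F p}))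
    {g : PowerSeries R} (h : angle F p ∣ PowerSeries.X * g) : angle F p ∣ g := by
  rcases hR with hR | hR
  · obtain ⟨q, hq⟩ := h
    have h0 := congrArg PowerSeries.constantCoeff hq
    rw [map_mul, map_mul, PowerSeries.constantCoeff_X, zero_mul, constantCoeff_angle,
      eq_comm, mul_left_mem_nonZeroDivisors_eq_zero_iff hR] at h0
    obtain ⟨q', rfl⟩ := PowerSeries.X_dvd_iff.2 h0
    refine ⟨q', PowerSeries.X_mul_cancel ?_⟩
    rw [hq]
    ring
  · rw [← Ideal.mem_span_singleton, ← Ideal.Quotient.eq_zero_iff_mem] at h ⊢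
    rwa [map_mul, mul_left_mem_nonZeroDivisors_eq_zero_iff hR] at h

theorem angleYT_dvd_of_dvd_X_mul (hT : ∀ g, angle F p ∣ PowerSeries.X * g → angle F p ∣ g)
    {g : MvPowerSeries (Fin 2) R} (h : angleYT F p ∣ X 1 * g) : angleYT F p ∣ g := by
  rw [algebraMap_dvd_iff] at h ⊢
  intro k
  refine hT _ ?_
  rw [← slice_smul, Algebra.smul_def, algebraMapT_X]
  exact h k

theorem angleYT_dvd_of_dvd_mul_shiftEquiv_sub (hp : p.Prime)
    (hT : ∀ g, angle F p ∣ PowerSeries.X * g → angle F p ∣ g) {n : ℤ} (hn : ¬ (p : ℤ) ∣ n)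
    {c : MvPowerSeries (Fin 2) R} (h : angleYT F p ∣ c * ((shiftEquiv F ^ n) (X 0) - X 0)) :
    angleYT F p ∣ c := by
  have hp0 : (p : ℤ) ≠ 0 := by exact_mod_cast hp.ne_zero
  -- The `n`-series is indexed by `ℕ`, so the integer `n` is replaced by its residue; this is
  -- harmless because `τ^p ≡ id`.
  obtain ⟨m, hm⟩ : ∃ m : ℕ, (m : ℤ) = n % p := ⟨_, Int.toNat_of_nonneg (Int.emod_nonneg n hp0)⟩
  have hd : (p : ℤ) ∣ n - m := hm ▸ Int.dvd_self_sub_emod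
  have hpm : ¬ p ∣ m := fun h' => hn <| by
    have := (dvd_add_right hd).2 (Int.natCast_dvd_natCast.2 h')
    rwa [add_comm, add_sub_cancel] at this
  have h1 : angleYT F p ∣ (shiftEquiv F ^ n) (X 0) - (shiftEquiv F ^ m) (X 0) := by
    have := angleYT_dvd_shiftEquiv_zpow_sub F p hd ((shiftEquiv F ^ m) (X 0))
    rwa [← RingAut.mul_apply, ← zpow_natCast, ← zpow_add, sub_add_cancel] at this
  obtain ⟨V, hV, hy⟩ := exists_yAdd_eq F (constantCoeff_nSeries F m)
  have h2 : angleYT F p ∣ X 1 * (c * angleYT F m * V) := by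
    have h3 := dvd_sub h (h1.mul_left c)
    convert h3 using 1
    rw [shiftEquiv_pow_X_zero, hy, algebraMapT_nSeries]
    ring
  have h4 := (hV.dvd_mul_right).1 (angleYT_dvd_of_dvd_X_mul F hT h2)
  refine IsCoprime.dvd_of_dvd_mul_right ?_ h4
  exact ((isCoprime_angle F ((Nat.Prime.coprime_iff_not_dvd hp).2 hpm))).map _

theorem constantCoeff_normY (hp : p ≠ 0) : constantCoeff (normY F p) = 0 := by
  rw [normY, map_prod]
  exact Finset.prod_eq_zero (Finset.mem_range.2 (Nat.pos_of_ne_zero hp))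
    (constantCoeff_yAdd F (constantCoeff_nSeries F 0))

theorem X_one_dvd_normY_sub : X 1 ∣ normY F p - X 0 ^ p := by
  rw [← Ideal.mem_span_singleton, ← Ideal.Quotient.eq]
  rw [normY, map_prod, map_pow, ← Finset.card_range p, ← Finset.prod_const, Finset.card_range]
  refine Finset.prod_congr rfl fun j _ => ?_
  rw [Ideal.Quotient.eq, Ideal.mem_span_singleton]
  obtain ⟨V, -, hy⟩ := exists_yAdd_eq F (constantCoeff_nSeries F j)
  rw [hy, add_sub_cancel_left, algebraMapT_nSeries, mul_assoc]
  exact dvd_mul_right _ _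

/-- The shift moves each factor to the next one; the only net change replaces the factor `y` by `y
+_F [p]`, which is congruent to it. -/
theorem angleYT_dvd_shiftEquiv_normY_sub (hp : p ≠ 0) :
    angleYT F p ∣ shiftEquiv F (normY F p) - normY F p := by
  have h : ∀ n, shiftEquiv F (yAdd F (nSeries F n)) = yAdd F (nSeries F (n + 1)) :=
    shift_yAdd_nSeries F
  obtain ⟨k, rfl⟩ := Nat.exists_eq_succ_of_ne_zero hp
  rw [normY, map_prod, Finset.prod_congr rfl fun n _ => h n, Finset.prod_range_succ,
    Finset.prod_range_succ', ← mul_sub]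
  refine Dvd.dvd.mul_left ?_ _
  rw [← shiftEquiv_pow_X_zero, nSeries, yAdd_zero]
  exact angleYT_dvd_shiftEquiv_pow_sub F _ _

theorem angleYT_dvd_shiftEquiv_substY_sub (hp : p ≠ 0) (g : MvPowerSeries (Fin 2) R) :
    angleYT F p ∣ shiftEquiv F (substY (constantCoeff_normY F hp) g) -
      substY (constantCoeff_normY F hp) g := by
  have hz := constantCoeff_normY F hp
  have hs : shiftEquiv F (substY hz g) = subst ![shiftEquiv F (normY F p), X 1] g := by
    rw [substY_apply]
    change substAlgHom (hasSubst_shift F) _ = subst ![substAlgHom (hasSubst_shift F) _, X 1] _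
    rw [substAlgHom_apply, substAlgHom_apply,
      subst_comp_subst_apply (hasSubst_pair hz) (hasSubst_shift F)]
    congr 1
    funext s
    fin_cases s
    · rfl
    · simp [subst_X (hasSubst_shift F)]
  rw [hs, substY_apply]
  refine (angleYT_dvd_shiftEquiv_normY_sub F hp).trans (sub_dvd_subst_sub ?_ hz (by simp) g)
  change constantCoeff (substAlgHom (hasSubst_shift F) _) = 0
  rw [substAlgHom_apply, constantCoeff_subst_eq, hz]
  exact constantCoeff_pair (constantCoeff_yAdd F PowerSeries.constantCoeff_X) (constantCoeff_X 1)

/-- Modulo `⟨p⟩_F`, the invariants of the shift are the power series in `t` and `normY F p`. -/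
theorem exists_angleYT_dvd_sub_substY (hp : p.Prime)
    (hT : ∀ g, angle F p ∣ PowerSeries.X * g → angle F p ∣ g)
    {f : MvPowerSeries (Fin 2) R} (h : angleYT F p ∣ shiftEquiv F f - f) :
    ∃ g, angleYT F p ∣ f - substY (constantCoeff_normY F hp.ne_zero) g := by
  have hz := constantCoeff_normY F hp.ne_zero
  have hA := shiftEquiv_algebraMapT F (angle F p)
  obtain ⟨g, hg⟩ := exists_eq_sum_X_pow_mul_substY hz hp.ne_zero (X_one_dvd_normY_sub F) f
  refine ⟨g 0, ?_⟩
  let π := Ideal.Quotient.mk (Ideal.span {angleYT F p})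
  have hπ : ∀ u v, π u = π v ↔ angleYT F p ∣ u - v := fun u v => by
    rw [Ideal.Quotient.eq, Ideal.mem_span_singleton]
  let v : Fin p → MvPowerSeries (Fin 2) R ⧸ Ideal.span {angleYT F p} :=
    fun j => π ((shiftEquiv F ^ (j : ℤ)) (X 0))
  have hdet : (Matrix.vandermonde v).det ∈ nonZeroDivisors _ := by
    rw [Matrix.det_vandermonde]
    refine Submonoid.prod_mem _ fun i _ => Submonoid.prod_mem _ fun j hj => ?_
    rw [mem_nonZeroDivisors_iff_right]
    intro x hx
    obtain ⟨c, rfl⟩ := Ideal.Quotient.mk_surjective x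
    have hij : (i : ℕ) < j := Fin.lt_def.1 (Finset.mem_Ioi.1 hj)
    have h1 : angleYT F p ∣
        c * ((shiftEquiv F ^ (j : ℤ)) (X 0) - (shiftEquiv F ^ (i : ℤ)) (X 0)) := by
      rw [← map_sub, ← map_mul, Ideal.Quotient.eq_zero_iff_mem, Ideal.mem_span_singleton] at hx
      exact hx
    -- Applying `τ^{-i}` turns the difference of two conjugates into `τ^{j-i} y - y`, where `0 < j -
    -- i < p`.
    have h2 := dvd_zpow_apply hA h1 (-(i : ℤ))
    rw [map_mul, map_sub, ← RingAut.mul_apply, ← RingAut.mul_apply, ← zpow_add, ← zpow_add,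
      neg_add_cancel, zpow_zero, RingAut.one_apply] at h2
    have h3 := angleYT_dvd_of_dvd_mul_shiftEquiv_sub F hp hT (fun hd => by
      have := Int.le_of_dvd (by omega) hd
      have := j.2
      omega) h2
    rw [dvd_zpow_apply_iff hA] at h3
    rwa [Ideal.Quotient.eq_zero_iff_mem, Ideal.mem_span_singleton]
  -- Row `j` is `τ^j` applied to `f = ∑ y^i gᵢ(z_F)`: modulo `⟨p⟩_F` both `f` and the `gᵢ(z_F)` are
  -- fixed. Subtracting `f` from the entry `0` makes the system homogeneous.
  have hv : (Matrix.vandermonde v).mulVec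
      (fun i => π (substY hz (g i)) - if (i : ℕ) = 0 then π f else 0) = 0 := by
    funext j
    have h1 : π f = ∑ i : Fin p, v j ^ (i : ℕ) * π (substY hz (g i)) := by
      have h2 := dvd_zpow_apply_sub hA h (j : ℤ)
      rw [← hπ] at h2
      rw [← h2, hg, map_sum, map_sum, Finset.sum_range]
      refine Finset.sum_congr rfl fun i _ => ?_
      rw [map_mul, map_mul, map_pow, map_pow]
      congr 1
      rw [hπ]
      exact dvd_zpow_apply_sub hA (angleYT_dvd_shiftEquiv_substY_sub F hp.ne_zero _) _
    have h3 : ∑ i : Fin p, v j ^ (i : ℕ) * (if (i : ℕ) = 0 then π f else 0) = π f := by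
      rw [Finset.sum_eq_single ⟨0, hp.pos⟩]
      · simp
      · intro i _ hi
        rw [if_neg, mul_zero]
        exact fun h => hi (Fin.ext h)
      · simp
    simp only [Matrix.mulVec, dotProduct, Matrix.vandermonde_apply, mul_sub,
      Finset.sum_sub_distrib, h3, ← h1, sub_self, Pi.zero_apply]
  have h0 := congrFun (Matrix.eq_zero_of_det_mem_nonZeroDivisors_of_mulVec_eq_zero hdet hv)
    ⟨0, hp.pos⟩
  simp only [if_true, Pi.zero_apply, sub_eq_zero] at h0
  exact (hπ _ _).1 h0.symm

end Invariants

/-! ### The center of the reduced Weyl algebra -/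

section Center

open MvPowerSeries

variable (F : FormalGroup R) (p : ℕ)

/-- The element `f xⁿ` of the `F`-Weyl algebra. -/
def monom (n : ℤ) (f : MvPowerSeries (Fin 2) R) : Weyl F :=
  SkewMonoidAlgebra.single (Multiplicative.ofAdd n) (toCoeff F f)

/-- The coefficient of `xⁿ`, written on the left, of an element of the `F`-Weyl algebra. -/
def wcoeff (w : Weyl F) (n : ℤ) : MvPowerSeries (Fin 2) R :=
  (toCoeff F).symm (w.coeff (Multiplicative.ofAdd n))

/-- The reduction of the `F`-Weyl algebra modulo `⟨p⟩_F`. -/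
def red : Weyl F →ₐ[PowerSeries R] WeylMod F p :=
  Algebra.TensorProduct.includeLeft

theorem red_apply (w : Weyl F) : red F p w = w ⊗ₜ 1 := rfl

theorem red_surjective : Function.Surjective (red F p) := by
  intro x
  obtain ⟨w, hw⟩ := Submodule.Quotient.mk_surjective _
    (TensorProduct.tensorQuotEquivQuotSMul (Weyl F) (Ideal.span {angle F p}) x)
  refine ⟨w, ?_⟩
  rw [red_apply, ← TensorProduct.tensorQuotEquivQuotSMul_symm_mk, hw, LinearEquiv.symm_apply_apply]

/-- The map `wcoeff F · n` as a homomorphism of additive groups. -/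
def wcoeffHom (n : ℤ) : Weyl F →+ MvPowerSeries (Fin 2) R where
  toFun w := wcoeff F w n
  map_zero' := map_zero (toCoeff F).symm
  map_add' w w' := by
    rw [wcoeff, SkewMonoidAlgebra.coeff_add, Finsupp.add_apply, map_add]
    rfl

theorem wcoeff_sub (w w' : Weyl F) (n : ℤ) : wcoeff F (w - w') n = wcoeff F w n - wcoeff F w' n :=
  map_sub (wcoeffHom F n) w w'

theorem wcoeff_sum {ι : Type*} (s : Finset ι) (w : ι → Weyl F) (n : ℤ) :
    wcoeff F (∑ i ∈ s, w i) n = ∑ i ∈ s, wcoeff F (w i) n :=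
  map_sum (wcoeffHom F n) w s

theorem wcoeff_smul (a : PowerSeries R) (w : Weyl F) (n : ℤ) :
    wcoeff F (a • w) n = a • wcoeff F w n := rfl

theorem wcoeff_ext {w w' : Weyl F} (h : ∀ n, wcoeff F w n = wcoeff F w' n) : w = w' :=
  SkewMonoidAlgebra.ext fun n => (toCoeff F).symm.injective (h n.toAdd)

theorem wcoeff_monom (m n : ℤ) (f : MvPowerSeries (Fin 2) R) :
    wcoeff F (monom F m f) n = if m = n then f else 0 := by
  classical
  rw [wcoeff, monom, SkewMonoidAlgebra.coeff_single_apply]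
  split_ifs with h h' h'
  · simp
  · exact absurd (Multiplicative.ofAdd.injective h) h'
  · exact absurd (congrArg _ h') h
  · simp

/-- The tensor product is the quotient of the Weyl algebra by multiples of `⟨p⟩_F`, and scalars from
`R⟦t⟧` act on each coefficient of `xⁿ` separately. -/
theorem red_eq_zero_iff (w : Weyl F) :
    red F p w = 0 ↔ ∀ n, angleYT F p ∣ wcoeff F w n := by
  rw [red_apply, ← TensorProduct.tensorQuotEquivQuotSMul_symm_mk, LinearEquiv.map_eq_zero_iff,
    Submodule.Quotient.mk_eq_zero, Submodule.ideal_span_singleton_smul,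
    Submodule.mem_smul_pointwise_iff_exists]
  constructor
  · rintro ⟨w', -, rfl⟩ n
    rw [wcoeff_smul, Algebra.smul_def]
    exact dvd_mul_right _ _
  · intro h
    choose d hd using h
    classical
    refine ⟨∑ n ∈ w.support, monom F n.toAdd (d n.toAdd), trivial, ?_⟩
    refine wcoeff_ext F fun n => ?_
    rw [wcoeff_smul]
    rw [wcoeff_sum]
    simp only [wcoeff_monom]
    by_cases hn : Multiplicative.ofAdd n ∈ w.support
    · rw [Finset.sum_eq_single (Multiplicative.ofAdd n)]
      · rw [if_pos (toAdd_ofAdd n), Algebra.smul_def, toAdd_ofAdd, ← hd]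
      · intro m _ hm
        rw [if_neg]
        rintro rfl
        exact hm rfl
      · exact fun h => absurd hn h
    · rw [Finset.sum_eq_zero, smul_zero]
      · rw [SkewMonoidAlgebra.notMem_support_iff] at hn
        rw [wcoeff, hn, map_zero]
      · intro m hm
        rw [if_neg]
        rintro rfl
        exact hn hm

theorem red_eq_iff (w w' : Weyl F) :
    red F p w = red F p w' ↔ ∀ n, angleYT F p ∣ wcoeff F w n - wcoeff F w' n := by
  rw [← sub_eq_zero, ← map_sub, red_eq_zero_iff]
  simp only [wcoeff_sub]

theorem red_monom_eq {f g : MvPowerSeries (Fin 2) R} (h : angleYT F p ∣ f - g) (n : ℤ) :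
    red F p (monom F n f) = red F p (monom F n g) := by
  rw [red_eq_iff]
  intro m
  rw [wcoeff_monom, wcoeff_monom]
  split_ifs
  · exact h
  · simp

/-- The sign comes from writing coefficients on the left: `g x = x τ(g)` means `x^m g = τ^{-m}(g)
x^m`. -/
theorem monom_mul_monom (m n : ℤ) (f g : MvPowerSeries (Fin 2) R) :
    monom F m f * monom F n g = monom F (m + n) (f * (shiftEquiv F ^ (-m)) g) := by
  rw [monom, monom, SkewMonoidAlgebra.single_mul_single, smul_coeff, inv_zpow', monom, map_mul]
  rfl

theorem sum_monom (w : Weyl F) :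
    ∑ n ∈ w.support, monom F n.toAdd (wcoeff F w n.toAdd) = w := by
  conv_rhs => rw [← SkewMonoidAlgebra.sum_single w]
  rfl

theorem wcoeff_monom_mul (m n : ℤ) (f : MvPowerSeries (Fin 2) R) (w : Weyl F) :
    wcoeff F (monom F m f * w) n = f * (shiftEquiv F ^ (-m)) (wcoeff F w (n - m)) := by
  rw [wcoeff, monom, SkewMonoidAlgebra.coeff_single_mul, map_mul, AlgEquiv.symm_apply_apply,
    ← ofAdd_neg, ← ofAdd_add, neg_add_eq_sub, ← inv_zpow']
  rfl

theorem wcoeff_mul_monom (m n : ℤ) (f : MvPowerSeries (Fin 2) R) (w : Weyl F) :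
    wcoeff F (w * monom F m f) n = wcoeff F w (n - m) * (shiftEquiv F ^ (m - n)) f := by
  rw [wcoeff, monom, SkewMonoidAlgebra.coeff_mul_single, map_mul, ← ofAdd_neg, ← ofAdd_add,
    ← sub_eq_add_neg, ← neg_sub n m, ← inv_zpow']
  rfl

variable {p}

/-- Against `g x^m`, the two products have coefficients `f τ^{-pn}(g)` and `g τ^{-m}(f)`, both
congruent to `f g`. -/
theorem commute_red_monom (n : ℤ) {f : MvPowerSeries (Fin 2) R}
    (hf : angleYT F p ∣ shiftEquiv F f - f) (x : WeylMod F p) :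
    Commute (red F p (monom F (p * n) f)) x := by
  obtain ⟨w, rfl⟩ := red_surjective F p x
  rw [← sum_monom F w, map_sum]
  refine Commute.sum_right (R := WeylMod F p) w.support
    (fun m => red F p (monom F m.toAdd (wcoeff F w m.toAdd))) _ fun m _ => ?_
  rw [commute_iff_eq, ← map_mul, ← map_mul, monom_mul_monom, monom_mul_monom, add_comm]
  refine red_monom_eq F p ?_ _
  have h1 := dvd_zpow_apply_sub (shiftEquiv_algebraMapT F (angle F p)) hf (-m.toAdd)
  have h2 := angleYT_dvd_shiftEquiv_zpow_sub F p
    (show (p : ℤ) ∣ -(p * n) from (dvd_mul_right _ _).neg_right) (wcoeff F w m.toAdd)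
  convert dvd_sub (h2.mul_left f) (h1.mul_left (wcoeff F w m.toAdd)) using 1
  ring

theorem angleYT_dvd_shiftEquiv_wcoeff_sub {w : Weyl F} (hw : ∀ x, Commute (red F p w) x) (n : ℤ) :
    angleYT F p ∣ shiftEquiv F (wcoeff F w n) - wcoeff F w n := by
  -- Commutation with `x`, read off at `x^(n+1)`, compares `fₙ` with `τ⁻¹ fₙ`.
  have h := (hw (red F p (monom F 1 1))).eq
  rw [← map_mul, ← map_mul, red_eq_iff] at h
  have h1 := h (n + 1)
  rw [wcoeff_mul_monom, wcoeff_monom_mul, add_sub_cancel_right, map_one, mul_one, one_mul] at h1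
  have h2 := dvd_zpow_apply (shiftEquiv_algebraMapT F (angle F p)) h1 1
  rwa [map_sub, ← RingAut.mul_apply _ _ (wcoeff F w n), ← zpow_add, add_neg_cancel, zpow_zero,
    RingAut.one_apply, zpow_one] at h2

theorem angleYT_dvd_wcoeff (hp : p.Prime)
    (hT : ∀ g, angle F p ∣ PowerSeries.X * g → angle F p ∣ g) {w : Weyl F}
    (hw : ∀ x, Commute (red F p w) x) {n : ℤ} (hn : ¬ (p : ℤ) ∣ n) :
    angleYT F p ∣ wcoeff F w n := by
  -- Commutation with `y`, read off at `xⁿ`, gives `fₙ (τ^{-n} y - y) ≡ 0`.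
  have h := (hw (red F p (monom F 0 (X 0)))).eq
  rw [← map_mul, ← map_mul, red_eq_iff] at h
  have h1 := h n
  rw [wcoeff_mul_monom, wcoeff_monom_mul, sub_zero, neg_zero, zpow_zero, RingAut.one_apply,
    mul_comm (X 0), ← mul_sub, zero_sub] at h1
  exact angleYT_dvd_of_dvd_mul_shiftEquiv_sub F hp hT (by rwa [dvd_neg]) h1

/-- The map `g(z, t) ↦ g(normY, t)` to the reduction of the `F`-Weyl algebra. -/
def redNorm (hp : p ≠ 0) : MvPowerSeries (Fin 2) R →ₐ[PowerSeries R] WeylMod F p :=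
  (red F p).comp <| AlgHom.comp
    { toFun := monom F 0
      map_one' := rfl
      map_mul' := fun f g => by simp [monom_mul_monom]
      map_zero' := SkewMonoidAlgebra.single_zero _
      map_add' := fun f g => SkewMonoidAlgebra.single_add _ _ _
      commutes' := fun _ => rfl } (substY (constantCoeff_normY F hp))

theorem redNorm_apply (hp : p ≠ 0) (g : MvPowerSeries (Fin 2) R) :
    redNorm F hp g = red F p (monom F 0 (substY (constantCoeff_normY F hp) g)) := rfl

/-- The powers of `x ^ p` in the reduction of the `F`-Weyl algebra. -/
def redPow (p : ℕ) : Multiplicative ℤ →* WeylMod F p where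
  toFun n := red F p (monom F (p * n.toAdd) 1)
  map_one' := by
    rw [toAdd_one, mul_zero]
    rfl
  map_mul' m n := by
    rw [← map_mul, monom_mul_monom, map_one, mul_one, toAdd_mul, mul_add]

theorem redPow_apply (n : Multiplicative ℤ) :
    redPow F p n = red F p (monom F (p * n.toAdd) 1) := rfl

theorem commute_redNorm_redPow (hp : p ≠ 0) (g : MvPowerSeries (Fin 2) R) (n : Multiplicative ℤ) :
    Commute (redNorm F hp g) (redPow F p n) :=
  (commute_red_monom F n.toAdd (by simp) _).symm

/-- The map `R⟦t⟧⟦z⟧[u, u⁻¹] → D ⊗ R⟦t⟧/⟨p⟩_F` with `u ↦ x ^ p` and `z ↦ normY`. -/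
def laurentToWeyl (hp : p ≠ 0) :
    (MvPowerSeries (Fin 2) R)[T;T⁻¹] →ₐ[PowerSeries R] WeylMod F p :=
  AddMonoidAlgebra.liftNCAlgHom (redNorm F hp) (redPow F p) (commute_redNorm_redPow F hp)

theorem laurentToWeyl_single (hp : p ≠ 0) (n : ℤ) (g : MvPowerSeries (Fin 2) R) :
    laurentToWeyl F hp (AddMonoidAlgebra.single n g) =
      red F p (monom F (p * n) (substY (constantCoeff_normY F hp) g)) := by
  rw [laurentToWeyl, AddMonoidAlgebra.coe_liftNCAlgHom, AddMonoidAlgebra.liftNC_single]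
  change redNorm F hp g * redPow F p (Multiplicative.ofAdd n) = _
  rw [redNorm_apply, redPow_apply, ← map_mul, monom_mul_monom, map_one, mul_one, zero_add]
  rfl

theorem laurentToWeyl_eq (hp : p ≠ 0) (l : (MvPowerSeries (Fin 2) R)[T;T⁻¹]) :
    laurentToWeyl F hp l = red F p (∑ n ∈ l.coeff.support,
      monom F (p * n) (substY (constantCoeff_normY F hp) (l.coeff n))) := by
  have hl : ∑ n ∈ l.coeff.support, AddMonoidAlgebra.single n (l.coeff n) = l :=
    AddMonoidAlgebra.sum_coeff_single l
  conv_lhs => rw [← hl]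
  rw [map_sum, map_sum]
  exact Finset.sum_congr rfl fun n _ => laurentToWeyl_single F hp n _

theorem laurentToWeyl_mem_center (hp : p ≠ 0) (l : (MvPowerSeries (Fin 2) R)[T;T⁻¹]) :
    laurentToWeyl F hp l ∈ Subalgebra.center (PowerSeries R) (WeylMod F p) := by
  rw [Subalgebra.mem_center_iff]
  intro x
  rw [laurentToWeyl_eq, map_sum]
  exact (Commute.sum_right (R := WeylMod F p) l.coeff.support (fun n => red F p
    (monom F (p * n) (substY (constantCoeff_normY F hp) (l.coeff n)))) x fun n _ =>
    (commute_red_monom F n (angleYT_dvd_shiftEquiv_substY_sub F hp _) x).symm).eq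

/-- Different powers of `u` go to different powers of `x`, so an element of the kernel has all its
`gₙ(z_F)` divisible by `⟨p⟩_F`; Weierstrass freeness then makes each `gₙ` divisible. -/
theorem ker_laurentToWeyl (hp : p ≠ 0) :
    RingHom.ker (laurentToWeyl F hp) =
      Ideal.span {algebraMap (PowerSeries R) (MvPowerSeries (Fin 2) R)[T;T⁻¹] (angle F p)} := by
  have hz := constantCoeff_normY F hp
  refine le_antisymm (fun l hl => ?_) ?_
  · rw [RingHom.mem_ker, laurentToWeyl_eq, red_eq_zero_iff] at hl
    have h : ∀ n, angleYT F p ∣ l.coeff n := fun n => by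
      by_cases hn : n ∈ l.coeff.support
      · have h1 := hl (p * n)
        rw [wcoeff_sum, Finset.sum_eq_single n] at h1
        · rw [wcoeff_monom, if_pos rfl] at h1
          exact algebraMap_dvd_of_dvd_substY hz hp (X_one_dvd_normY_sub F) _ _ h1
        · intro m _ hm
          rw [wcoeff_monom, if_neg]
          intro h
          exact hm (mul_left_cancel₀ (by exact_mod_cast hp) h)
        · exact fun h => absurd hn h
      · rw [Finsupp.notMem_support_iff.1 hn]
        exact dvd_zero _
    choose d hd using h
    have hl : ∑ n ∈ l.coeff.support, AddMonoidAlgebra.single n (l.coeff n) = l :=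
      AddMonoidAlgebra.sum_coeff_single l
    rw [← hl]
    refine Ideal.sum_mem _ fun n _ => ?_
    rw [Ideal.mem_span_singleton]
    refine ⟨AddMonoidAlgebra.single n (d n), ?_⟩
    rw [← Algebra.smul_def, AddMonoidAlgebra.smul_single, Algebra.smul_def, ← hd]
  · rw [Ideal.span_singleton_le_iff_mem, RingHom.mem_ker, AlgHom.commutes,
      ← (red F p).commutes, red_eq_zero_iff]
    intro n
    change angleYT F p ∣ wcoeff F (monom F 0 (angleYT F p)) n
    rw [wcoeff_monom]
    split_ifs <;> simp

theorem exists_laurentToWeyl_eq (hp : p.Prime)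
    (hT : ∀ g, angle F p ∣ PowerSeries.X * g → angle F p ∣ g) {x : WeylMod F p}
    (hx : ∀ y, Commute x y) : ∃ l, laurentToWeyl F hp.ne_zero l = x := by
  obtain ⟨w, rfl⟩ := red_surjective F p x
  change red F p w ∈ (laurentToWeyl F hp.ne_zero).range
  rw [← sum_monom F w, map_sum]
  refine Subalgebra.sum_mem _ fun m _ => ?_
  by_cases hm : (p : ℤ) ∣ m.toAdd
  · obtain ⟨n, hn⟩ := hm
    obtain ⟨g, hg⟩ := exists_angleYT_dvd_sub_substY F hp hT
      (angleYT_dvd_shiftEquiv_wcoeff_sub F hx m.toAdd)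
    refine ⟨AddMonoidAlgebra.single n g, ?_⟩
    change laurentToWeyl F hp.ne_zero _ = _
    rw [laurentToWeyl_single, ← hn]
    exact (red_monom_eq F p hg _).symm
  · have h0 : red F p (monom F m.toAdd (wcoeff F w m.toAdd)) = red F p (monom F m.toAdd 0) :=
      red_monom_eq F p (by simpa using angleYT_dvd_wcoeff F hp hT hx hm) _
    rw [h0, monom, map_zero, SkewMonoidAlgebra.single_zero, map_zero]
    exact Subalgebra.zero_mem _

end Center

end FWeyl

end

/-! ### The isomorphism onto the center -/

theorem mainTheorem12 {R : Type*} [CommRing R] (F : FormalGroup R) (p : ℕ) (hp : p.Prime)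
    (hR : (p : R) ∈ nonZeroDivisors R ∨
      Ideal.Quotient.mk (Ideal.span {angle F p}) (PowerSeries.X : PowerSeries R) ∈
        nonZeroDivisors (PowerSeries R ⧸ Ideal.span {angle F p})) :
    ∃ e : LaurentMod F p ≃ₐ[PowerSeries R] Subalgebra.center (PowerSeries R) (WeylMod F p),
      (∀ n : ℤ, (e (Ideal.Quotient.mk _ (LaurentPolynomial.T n)) : WeylMod F p) =
        xPow F (p * n) ⊗ₜ 1) ∧
      (∀ g : MvPowerSeries (Fin 2) R,
        (e (Ideal.Quotient.mk _ (LaurentPolynomial.C g)) : WeylMod F p) =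
          ofYT F (g.subst ![normY F p, MvPowerSeries.X 1]) ⊗ₜ 1) := by
  have hp0 := hp.ne_zero
  let φ : (MvPowerSeries (Fin 2) R)[T;T⁻¹] →ₐ[PowerSeries R]
      Subalgebra.center (PowerSeries R) (WeylMod F p) :=
    (laurentToWeyl F hp0).codRestrict _ (laurentToWeyl_mem_center F hp0)
  have hφ : Function.Surjective φ := by
    rintro ⟨x, hx⟩
    obtain ⟨l, hl⟩ := exists_laurentToWeyl_eq F hp (fun g => angle_dvd_of_dvd_X_mul F hR)
      (x := x) fun y => ((Subalgebra.mem_center_iff.1 hx) y).symm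
    exact ⟨l, Subtype.ext hl⟩
  have hker : Ideal.span {algebraMap (PowerSeries R) (MvPowerSeries (Fin 2) R)[T;T⁻¹]
      (angle F p)} = RingHom.ker φ := by
    rw [← ker_laurentToWeyl F hp0]
    ext l
    rw [RingHom.mem_ker, RingHom.mem_ker, Subtype.ext_iff]
    rfl
  refine ⟨(Ideal.quotientEquivAlgOfEq (PowerSeries R) hker).trans
    (Ideal.quotientKerAlgEquivOfSurjective hφ), fun n => ?_, fun g => ?_⟩
  · change laurentToWeyl F hp0 (AddMonoidAlgebra.single n 1) = _
    rw [laurentToWeyl_single, map_one]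
    rfl
  · change laurentToWeyl F hp0 (AddMonoidAlgebra.single 0 g) = _
    rw [laurentToWeyl_single, mul_zero, substY_apply]
    rfl
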